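/- Write $\omega=\{0,1,2,\dots\}$. For a nonempty finite set $B$, order $\omega^B$ pointwise, call $M\subseteq\omega^B$ an upper set if $x\in M$ and $x\le y$ imply $y\in M$, and let $0\in\omega^B$ be the zero function. For $T\in\omega$ let $\mu_T$ be the uniform probability measure on the finite set $\{f\in\omega^B : \sum_{b\in B} f(b)=T\}$, regarded as a measure on $\omega^B$. For real $T\ge 0$ let $\nu_T$ be the probability measure on $\omega^B$ that is the product of $\#B$ copies of the geometric distribution $n\mapsto p(1-p)^n$ on $\omega$ (with $0^0=1$) with parameter $p=(1+T/\#B)^{-1}$. If $\emptyset\ne M\subseteq\omega^B$ is an upper set with $0\notin M$, its uniform threshold is the least $T\in\omega$ with $\mu_T(M)\ge\frac12$, and its geometric threshold is the unique real $T'>0$ with $\nu_{T'}(M)=\frac12$. Theorem. Let $(B_i)_{i\in\omega}$ be a sequence of nonempty finite sets, and for each $i$ let $M_i\subseteq\omega^{B_i}$ be a nonempty upper set with $0\notin M_i$, with uniform threshold $T_i$ and geometric threshold $T'_i$. If $\#B_i\to\infty$ and $T'_i\to\infty$ as $i\to\infty$, then $T_i/T'_i\to 1$ as $i\to\infty$.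 -/

import Mathlib

open MeasureTheory ProbabilityTheory Filter Topology
open scoped NNReal ENNReal

/-- The uniform probability distribution `μ_T` on the multisets `f : B → ℕ` of total size
`∑ b, f b = T` (and zero on all other multisets). -/
noncomputable def uniformMultiset (B : Type*) [Fintype B] (T : ℕ) : Measure (B → ℕ) :=
  uniformOn {f : B → ℕ | ∑ b, f b = T}

/-- The parameter `(1 + T / #B)⁻¹`, as an element of the unit interval. -/
noncomputable def geometricParam (B : Type*) [Fintype B] (T : ℝ≥0) : unitInterval :=
  ⟨(1 + (T : ℝ) / (Fintype.card B : ℝ))⁻¹,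
    inv_nonneg.2 (by positivity), inv_le_one_of_one_le₀ (le_add_of_nonneg_right (by positivity))⟩

/-- The distribution `ν_T` on multisets `f : B → ℕ`: the product of `#B` copies of the geometric
distribution (number of failures, `n ↦ p * (1 - p) ^ n`) with parameter
`p = (1 + T / #B)⁻¹`. -/
noncomputable def geometricMultiset (B : Type*) [Fintype B] (T : ℝ≥0) : Measure (B → ℕ) :=
  Measure.pi fun _ : B => geometricMeasure (geometricParam B T)

/-- `T` is the uniform threshold of the family `M` of multisets: the least natural number with
`μ_T(M) ≥ 1/2`. -/
def IsUniformThreshold {B : Type*} [Fintype B] (M : Set (B → ℕ)) (T : ℕ) : Prop :=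
  IsLeast {U : ℕ | 1 / 2 ≤ uniformMultiset B U M} T

/-- `T` is the geometric threshold of the family `M` of multisets: a positive real number with
`ν_T(M) = 1/2`. Uniqueness of such a `T` is a fact about nonempty upper sets `M` that do not
contain `0`; it is not made part of the predicate, so that it is not assumed where the predicate
is a hypothesis. -/
def IsGeometricThreshold {B : Type*} [Fintype B] (M : Set (B → ℕ)) (T : ℝ≥0) : Prop :=
  0 < T ∧ geometricMultiset B T M = 1 / 2

/-! Under the product of geometric laws with ratio `r = 1 - p`, a point's weight depends only on its
total size `N`. The geometric mass `V(r)` of an upper set `M` is therefore an average over `N` of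
the shares of `M` in the levels. Two facts make the thresholds agree.

The threshold of `V` is not too coarse. A Poincaré inequality for monotone functions gives `V (1 -
V) ≤ (1 - r) Cov(N, 1_M)` (`geometricMass_variance_le`), and Russo's formula gives `V' = Cov(N, 1_M)
/ r`. Hence the odds `V / (1 - V)` grow at least as fast as `r / (1 - r)`, which is proportional to
the mean `U` of `N` (`antitoneOn_odds`). The odds are 1 at `U = T'`, so moving `U` by a factor `1 ±
ε/2` moves `V` away from 1/2 by order `ε`.

The size `N` is concentrated. Its variance is `U + U ^ 2 / #B`, which is `o(T' ^ 2)` for `U ≤ 2 T'`.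
If `T` were outside `(1 ± ε) T'`, nearly all the mass of `N` would lie on levels where the share of
`M` is on the wrong side of 1/2, contradicting the first fact. For the lower bound on `T` this uses
that shares increase with the level (`monotone_level_ratio`). -/

/-! ### Counting in the levels: double counting and normalized matching. -/

section Levels

variable {B : Type*} [Fintype B]

open Classical in
/-- The finite set of the `f ∈ M` of total size `n`. -/
noncomputable def level (M : Set (B → ℕ)) (n : ℕ) : Finset (B → ℕ) :=
  {f ∈ Finset.univ.piAntidiag n | f ∈ M}

lemma mem_level {M : Set (B → ℕ)} {n : ℕ} {f : B → ℕ} :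
    f ∈ level M n ↔ ∑ b, f b = n ∧ f ∈ M := by
  simp [level]

lemma level_subset_univ (M : Set (B → ℕ)) (n : ℕ) : level M n ⊆ level Set.univ n := by
  intro f hf
  rw [mem_level] at hf ⊢
  exact ⟨hf.1, trivial⟩

lemma coe_level_univ (n : ℕ) :
    (level (Set.univ : Set (B → ℕ)) n : Set (B → ℕ)) = {f | ∑ b, f b = n} := by
  ext f; simp [mem_level]

lemma card_level_le_pow (M : Set (B → ℕ)) (n : ℕ) :
    (level M n).card ≤ (n + 1) ^ Fintype.card B := by
  classical
  have h : level M n ⊆ Fintype.piFinset fun _ : B => Finset.range (n + 1) := by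
    intro f hf
    rw [mem_level] at hf
    simp only [Fintype.mem_piFinset, Finset.mem_range]
    intro b
    have := Finset.single_le_sum (f := f) (fun _ _ => Nat.zero_le _) (Finset.mem_univ b)
    omega
  refine (Finset.card_le_card h).trans ?_
  simp

lemma card_level_pos [Nonempty B] (n : ℕ) : 0 < (level (Set.univ : Set (B → ℕ)) n).card := by
  classical
  obtain ⟨b⟩ := ‹Nonempty B›
  refine Finset.card_pos.2 ⟨Pi.single b n, mem_level.2 ⟨?_, trivial⟩⟩
  simp

open Classical in
/-- Counting the pairs `(f, f + e_b)` with `f` of size `n`, each with weight `f b + 1`. -/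
lemma sum_level_succ (φ : (B → ℕ) → ℕ) (n : ℕ) :
    (n + Fintype.card B) * ∑ f ∈ level (Set.univ : Set (B → ℕ)) n, φ f =
      ∑ g ∈ level (Set.univ : Set (B → ℕ)) (n + 1), ∑ b, g b * φ (g - Pi.single b 1) := by
  rw [Finset.sum_comm]
  have key : ∀ b : B, ∑ f ∈ level (Set.univ : Set (B → ℕ)) n, (f b + 1) * φ f =
      ∑ g ∈ level (Set.univ : Set (B → ℕ)) (n + 1), g b * φ (g - Pi.single b 1) := by
    intro b
    refine Finset.sum_of_injOn (fun f => f + Pi.single b 1) ?_ ?_ ?_ ?_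
    · intro f _ g _ h
      exact add_right_cancel h
    · intro f hf
      rw [Finset.mem_coe, mem_level] at hf ⊢
      simp [Finset.sum_add_distrib, hf.1]
    · intro g hg hg'
      rw [mem_level] at hg
      -- A `g` outside the image of the shift vanishes at `b`, so its weight is zero.
      have : g b = 0 := by
        by_contra hb
        apply hg'
        have hle : Pi.single b 1 ≤ g := by
          intro c
          rcases eq_or_ne c b with rfl | hc
          · rw [Pi.single_eq_same]; exact Nat.one_le_iff_ne_zero.2 hb
          · simp [Pi.single_eq_of_ne hc]
        have hs : g - Pi.single b 1 + Pi.single b 1 = g := tsub_add_cancel_of_le hle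
        refine ⟨g - Pi.single b 1, ?_, hs⟩
        have h1 := hg.1
        rw [← hs] at h1
        simp only [Pi.add_apply, Finset.sum_add_distrib] at h1
        rw [Finset.mem_coe, mem_level]
        refine ⟨?_, trivial⟩
        simpa using h1
      simp [this]
    · intro f _
      simp
  rw [← Finset.sum_congr rfl fun b _ => key b, Finset.sum_comm, Finset.mul_sum]
  refine Finset.sum_congr rfl fun f hf => ?_
  rw [mem_level] at hf
  rw [← Finset.sum_mul, Finset.sum_add_distrib, hf.1]
  simp

lemma card_level_univ_succ (n : ℕ) :
    (n + 1) * (level (Set.univ : Set (B → ℕ)) (n + 1)).card =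
      (n + Fintype.card B) * (level (Set.univ : Set (B → ℕ)) n).card := by
  have h := sum_level_succ (B := B) (fun _ => 1) n
  simp only [mul_one, Finset.sum_const, smul_eq_mul] at h
  rw [h, Finset.sum_congr rfl fun g hg => (mem_level.1 hg).1]
  simp [mul_comm]

/-- Weighted double counting with the indicator of `M`: whenever `g - e_b` lies in `M`, so does `g`.
This is a local LYM inequality. -/
lemma card_level_succ_of_isUpperSet {M : Set (B → ℕ)} (hM : IsUpperSet M) (n : ℕ) :
    (n + Fintype.card B) * (level M n).card ≤ (n + 1) * (level M (n + 1)).card := by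
  classical
  have hc : ∀ k, (level M k).card =
      ∑ f ∈ level (Set.univ : Set (B → ℕ)) k, if f ∈ M then 1 else 0 := by
    intro k
    rw [← Finset.card_filter]
    congr 1
    ext f
    simp [mem_level]
  rw [hc n, sum_level_succ, hc (n + 1), Finset.mul_sum]
  refine Finset.sum_le_sum fun g hg => ?_
  rw [← (mem_level.1 hg).1, Finset.sum_mul]
  refine Finset.sum_le_sum fun b _ => Nat.mul_le_mul le_rfl ?_
  split_ifs with h1 h2 <;> try simp
  exact h2 (hM tsub_le_self h1)

/-- The proportion of an upper set in the levels is nondecreasing. -/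
lemma monotone_level_ratio [Nonempty B] {M : Set (B → ℕ)} (hM : IsUpperSet M) :
    Monotone fun n => ((level M n).card : ℝ) / (level (Set.univ : Set (B → ℕ)) n).card := by
  refine monotone_nat_of_le_succ fun n => ?_
  have ha : (0 : ℝ) < (level (Set.univ : Set (B → ℕ)) n).card := by
    exact_mod_cast card_level_pos n
  have ha' : (0 : ℝ) < (level (Set.univ : Set (B → ℕ)) (n + 1)).card := by
    exact_mod_cast card_level_pos (n + 1)
  have h1 : ((n : ℝ) + 1) * (level (Set.univ : Set (B → ℕ)) (n + 1)).card =
      (n + Fintype.card B) * (level (Set.univ : Set (B → ℕ)) n).card := by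
    exact_mod_cast card_level_univ_succ (B := B) n
  have h2 : ((n : ℝ) + Fintype.card B) * (level M n).card ≤
      (n + 1) * (level M (n + 1)).card := by
    exact_mod_cast card_level_succ_of_isUpperSet hM n
  rw [div_le_div_iff₀ ha ha']
  have hn : (0 : ℝ) < n + 1 := by positivity
  refine le_of_mul_le_mul_left ?_ hn
  calc ((n : ℝ) + 1) * ((level M n).card * (level (Set.univ : Set (B → ℕ)) (n + 1)).card)
      = (((n : ℝ) + Fintype.card B) * (level M n).card) *
          (level (Set.univ : Set (B → ℕ)) n).card := by linear_combination (level M n).card * h1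
    _ ≤ ((n + 1) * (level M (n + 1)).card) * (level (Set.univ : Set (B → ℕ)) n).card := by
        gcongr
    _ = _ := by ring

lemma uniformMultiset_apply (M : Set (B → ℕ)) (n : ℕ) :
    uniformMultiset B n M =
      ((level M n).card : ℝ≥0∞) / (level (Set.univ : Set (B → ℕ)) n).card := by
  classical
  have hfin : ({f : B → ℕ | ∑ b, f b = n}).Finite := by
    rw [← coe_level_univ]; exact Finset.finite_toSet _
  have hinter : ({f : B → ℕ | ∑ b, f b = n} ∩ M) = (level M n : Set (B → ℕ)) := by
    ext f; simp [mem_level]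
  rw [uniformMultiset, ← uniformOn_inter_self hfin, hinter, ← coe_level_univ,
    uniformOn_apply_finset, Finset.inter_eq_right.2 (level_subset_univ M n)]

lemma half_le_uniformMultiset_iff [Nonempty B] (M : Set (B → ℕ)) (n : ℕ) :
    1 / 2 ≤ uniformMultiset B n M ↔
      ((level (Set.univ : Set (B → ℕ)) n).card : ℝ) ≤ 2 * (level M n).card := by
  have ha := card_level_pos (B := B) n
  rw [uniformMultiset_apply, ENNReal.le_div_iff_mul_le (by left; simpa using ha.ne')
    (by left; simp), one_div, mul_comm, ← div_eq_mul_inv,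
    ENNReal.div_le_iff_le_mul (by simp) (by simp)]
  norm_cast
  rw [mul_comm]

end Levels

/-! ### A Poincaré inequality for monotone functions of geometric variables. -/

section Poincare

/-- The covariance inequality for the geometric weights `(1 - r) * r ^ n`: a nondecreasing
`h : ℕ → [0, 1]` satisfies `Var h ≤ (1 - r) * Cov (id, h)`. -/
lemma geometric_variance_le_real {r : ℝ} (hr0 : 0 ≤ r) (hr1 : r < 1) {h : ℕ → ℝ}
    (hm : Monotone h) (h0 : ∀ n, 0 ≤ h n) (h1 : ∀ n, h n ≤ 1) :
    (∑' n, r ^ n * (1 - r) * h n ^ 2) + r * (∑' n, r ^ n * (1 - r) * h n) ≤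
      (1 - r) * (∑' n : ℕ, r ^ n * (1 - r) * (n * h n)) +
        (∑' n, r ^ n * (1 - r) * h n) ^ 2 := by
  have hq : 0 < 1 - r := by linarith
  have hgeo : Summable fun n : ℕ => r ^ n * (1 - r) :=
    (summable_geometric_of_lt_one hr0 hr1).mul_right _
  have hgeo1 : Summable fun n : ℕ => r ^ n * (1 - r) * n := by
    have := (summable_pow_mul_geometric_of_norm_lt_one 1 (r := r)
      (by rwa [Real.norm_of_nonneg hr0])).mul_right (1 - r)
    refine this.congr fun n => ?_
    ring
  have htot : ∑' n : ℕ, r ^ n * (1 - r) = 1 := by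
    rw [tsum_mul_right, tsum_geometric_of_lt_one hr0 hr1, inv_mul_cancel₀ hq.ne']
  have hw : ∀ n : ℕ, 0 ≤ r ^ n * (1 - r) := fun n => by positivity
  have s1 : ∀ g : ℕ → ℝ, (∀ n, 0 ≤ g n) → (∀ n, g n ≤ 1) →
      Summable fun n => r ^ n * (1 - r) * g n := fun g g0 g1 =>
    Summable.of_nonneg_of_le (fun n => mul_nonneg (hw n) (g0 n))
      (fun n => mul_le_of_le_one_right (hw n) (g1 n)) hgeo
  have s2 : ∀ g : ℕ → ℝ, (∀ n, 0 ≤ g n) → (∀ n, g n ≤ 1) →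
      Summable fun n : ℕ => r ^ n * (1 - r) * (n * g n) := fun g g0 g1 => by
    refine Summable.of_nonneg_of_le
      (fun n => mul_nonneg (hw n) (mul_nonneg n.cast_nonneg (g0 n))) (fun n => ?_) hgeo1
    exact mul_le_mul_of_nonneg_left (mul_le_of_le_one_right n.cast_nonneg (g1 n)) (hw n)
  -- `G g` is the slack in the inequality. A crude lower bound on `G`, improved by a factor `r` at
  -- each shift of `g`, forces `0 ≤ G h`.
  set G : (ℕ → ℝ) → ℝ := fun g =>
    (1 - r) * (∑' n : ℕ, r ^ n * (1 - r) * (n * g n)) + (∑' n, r ^ n * (1 - r) * g n) ^ 2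
      - (∑' n, r ^ n * (1 - r) * g n ^ 2) - r * (∑' n, r ^ n * (1 - r) * g n) with hG
  have sq0 : ∀ g : ℕ → ℝ, (∀ n, 0 ≤ g n) → (∀ n, g n ≤ 1) → ∀ n, g n ^ 2 ≤ 1 :=
    fun g g0 g1 n => pow_le_one₀ (g0 n) (g1 n)
  have le1 : ∀ g : ℕ → ℝ, (∀ n, 0 ≤ g n) → (∀ n, g n ≤ 1) →
      ∑' n, r ^ n * (1 - r) * g n ≤ 1 := fun g g0 g1 => by
    exact ((s1 g g0 g1).tsum_le_tsum (fun n => mul_le_of_le_one_right (hw n) (g1 n)) hgeo).trans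
      htot.le
  have lower : ∀ g : ℕ → ℝ, (∀ n, 0 ≤ g n) → (∀ n, g n ≤ 1) → -2 ≤ G g := by
    intro g g0 g1
    have e1 := le1 g g0 g1
    have e2 := le1 (fun n => g n ^ 2) (fun n => sq_nonneg _) (sq0 g g0 g1)
    have e3 : 0 ≤ ∑' n : ℕ, r ^ n * (1 - r) * (n * g n) :=
      tsum_nonneg fun n => mul_nonneg (hw n) (mul_nonneg n.cast_nonneg (g0 n))
    have e4 : r * (∑' n, r ^ n * (1 - r) * g n) ≤ 1 * 1 := by
      gcongr
      exact tsum_nonneg fun n => mul_nonneg (hw n) (g0 n)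
    have e5 := mul_nonneg hq.le e3
    simp only [hG]
    nlinarith [sq_nonneg (∑' n, r ^ n * (1 - r) * g n)]
  -- Memorylessness: the variable is 0 with probability `1 - r`, and otherwise one more than a copy
  -- of itself. With `d = e - g 0`, `e` the mean of the shifted function, the difference of the two
  -- sides is exactly `r (1 - r) d (1 - d)`. Monotonicity and the bounds on `g` give `0 ≤ d ≤ 1`.
  have step : ∀ g : ℕ → ℝ, Monotone g → (∀ n, 0 ≤ g n) → (∀ n, g n ≤ 1) →
      r * G (fun n => g (n + 1)) ≤ G g := by
    intro g gm g0 g1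
    have r1 : ∑' n, r ^ n * (1 - r) * g n =
        (1 - r) * g 0 + r * ∑' n, r ^ n * (1 - r) * g (n + 1) := by
      rw [(s1 g g0 g1).tsum_eq_zero_add, ← tsum_mul_left]
      congr 1
      · ring
      · exact tsum_congr fun n => by ring
    have r2 : ∑' n, r ^ n * (1 - r) * g n ^ 2 =
        (1 - r) * g 0 ^ 2 + r * ∑' n, r ^ n * (1 - r) * g (n + 1) ^ 2 := by
      rw [(s1 (fun n => g n ^ 2) (fun n => sq_nonneg _) (sq0 g g0 g1)).tsum_eq_zero_add,
        ← tsum_mul_left]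
      congr 1
      · ring
      · exact tsum_congr fun n => by ring
    have r3 : ∑' n : ℕ, r ^ n * (1 - r) * (n * g n) =
        r * (∑' n : ℕ, r ^ n * (1 - r) * (n * g (n + 1))) +
          r * ∑' n, r ^ n * (1 - r) * g (n + 1) := by
      rw [(s2 g g0 g1).tsum_eq_zero_add, ← mul_add,
        ← (s2 (fun n => g (n + 1)) (fun n => g0 _) (fun n => g1 _)).tsum_add
          (s1 (fun n => g (n + 1)) (fun n => g0 _) (fun n => g1 _)), ← tsum_mul_left]
      simp only [Nat.cast_zero, zero_mul, mul_zero, zero_add]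
      exact tsum_congr fun n => by push_cast; ring
    have d0 : g 0 ≤ ∑' n, r ^ n * (1 - r) * g (n + 1) := by
      have hc : ∑' n : ℕ, r ^ n * (1 - r) * g 0 = g 0 := by rw [tsum_mul_right, htot, one_mul]
      refine hc.symm.le.trans ?_
      exact (hgeo.mul_right _).tsum_le_tsum
        (fun n => mul_le_mul_of_nonneg_left (gm (Nat.zero_le _)) (hw n))
        (s1 (fun n => g (n + 1)) (fun n => g0 _) (fun n => g1 _))
    have d1 := le1 (fun n => g (n + 1)) (fun n => g0 _) (fun n => g1 _)
    have a0 := g0 0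
    simp only [hG]
    rw [r1, r2, r3]
    set e := ∑' n, r ^ n * (1 - r) * g (n + 1)
    have hd : 0 ≤ r * (1 - r) * ((e - g 0) * (1 - (e - g 0))) := by
      refine mul_nonneg (mul_nonneg hr0 hq.le) (mul_nonneg ?_ ?_) <;> linarith
    nlinarith [hd]
  have iter : ∀ (k : ℕ) (g : ℕ → ℝ), Monotone g → (∀ n, 0 ≤ g n) → (∀ n, g n ≤ 1) →
      -2 * r ^ k ≤ G g := by
    intro k
    induction k with
    | zero => intro g _ g0 g1; simpa using lower g g0 g1
    | succ k ih =>
      intro g gm g0 g1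
      have := ih (fun n => g (n + 1)) (fun a b hab => gm (by omega)) (fun n => g0 _)
        (fun n => g1 _)
      have h2 := step g gm g0 g1
      have h3 := mul_le_mul_of_nonneg_left this hr0
      calc -2 * r ^ (k + 1) = r * (-2 * r ^ k) := by ring
        _ ≤ _ := h3.trans h2
  have hlim : Tendsto (fun k : ℕ => -2 * r ^ k) atTop (𝓝 (-2 * 0)) :=
    (tendsto_pow_atTop_nhds_zero_of_lt_one hr0 hr1).const_mul _
  have hpos : 0 ≤ G h := by
    have := le_of_tendsto' hlim (fun k => iter k h hm h0 h1)
    simpa using this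
  simp only [hG] at hpos
  linarith

lemma lintegral_ofReal_geometricMeasure {p : unitInterval} (hp : p ≠ 0) {f : ℕ → ℝ}
    (h0 : ∀ n, 0 ≤ f n) (hs : Summable fun n => (1 - p : ℝ) ^ n * p * f n) :
    ∫⁻ n, ENNReal.ofReal (f n) ∂geometricMeasure p =
      ENNReal.ofReal (∑' n, (1 - p : ℝ) ^ n * p * f n) := by
  rw [lintegral_countable', ENNReal.ofReal_tsum_of_nonneg
    (fun n => mul_nonneg (geometricMeasure_nonneg p n) (h0 n)) hs]
  refine tsum_congr fun n => ?_
  rw [geometricMeasure_singleton hp, mul_comm, ENNReal.ofReal_mul (geometricMeasure_nonneg p n)]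

/-- The subtraction-free form in `ℝ≥0∞`, needed to integrate over further coordinates with
`lmarginal`. -/
lemma geometric_variance_le {p : unitInterval} (hp : p ≠ 0) {h : ℕ → ℝ≥0∞}
    (hm : Monotone h) (h1 : ∀ n, h n ≤ 1) :
    ∫⁻ n, h n ^ 2 ∂geometricMeasure p +
        ENNReal.ofReal (1 - p) * ∫⁻ n, h n ∂geometricMeasure p ≤
      ENNReal.ofReal p * ∫⁻ n : ℕ, n * h n ∂geometricMeasure p +
        (∫⁻ n, h n ∂geometricMeasure p) ^ 2 := by
  have hp0 : 0 < (p : ℝ) := lt_of_le_of_ne p.2.1 fun h => hp (Subtype.ext h.symm)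
  have hr0 : 0 ≤ 1 - (p : ℝ) := by linarith [p.2.2]
  have hr1 : 1 - (p : ℝ) < 1 := by linarith
  have htop : ∀ n, h n ≠ ⊤ := fun n => ne_top_of_le_ne_top ENNReal.one_ne_top (h1 n)
  have hg : ∀ n, h n = ENNReal.ofReal (h n).toReal := fun n => (ENNReal.ofReal_toReal (htop n)).symm
  have g0 : ∀ n, 0 ≤ (h n).toReal := fun n => ENNReal.toReal_nonneg
  have g1 : ∀ n, (h n).toReal ≤ 1 := fun n => ENNReal.toReal_le_of_le_ofReal zero_le_one
    (by simpa using h1 n)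
  have gm : Monotone fun n => (h n).toReal := fun a b hab =>
    ENNReal.toReal_mono (htop b) (hm hab)
  have key := geometric_variance_le_real hr0 hr1 gm g0 g1
  simp only [sub_sub_cancel] at key
  have hw := geometricMeasure_nonneg p
  have hgeo := (hasSum_one_geometricMeasure hp).summable
  have hgeo1 : Summable fun n : ℕ => (1 - p : ℝ) ^ n * p * n := by
    have := (summable_pow_mul_geometric_of_norm_lt_one 1 (r := 1 - (p : ℝ))
      (by rwa [Real.norm_of_nonneg hr0])).mul_right (p : ℝ)
    refine this.congr fun n => ?_
    ring
  have e1 : ∫⁻ n, h n ∂geometricMeasure p =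
      ENNReal.ofReal (∑' n, (1 - p : ℝ) ^ n * p * (h n).toReal) := by
    rw [← lintegral_ofReal_geometricMeasure hp g0]
    · exact lintegral_congr hg
    · exact Summable.of_nonneg_of_le (fun n => mul_nonneg (hw n) (g0 n))
        (fun n => mul_le_of_le_one_right (hw n) (g1 n)) hgeo
  have e2 : ∫⁻ n, h n ^ 2 ∂geometricMeasure p =
      ENNReal.ofReal (∑' n, (1 - p : ℝ) ^ n * p * (h n).toReal ^ 2) := by
    rw [← lintegral_ofReal_geometricMeasure hp (fun n => sq_nonneg _)]
    · refine lintegral_congr fun n => ?_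
      rw [ENNReal.ofReal_pow (g0 n), ← hg]
    · exact Summable.of_nonneg_of_le (fun n => mul_nonneg (hw n) (sq_nonneg _))
        (fun n => mul_le_of_le_one_right (hw n) (pow_le_one₀ (g0 n) (g1 n))) hgeo
  have e3 : ∫⁻ n : ℕ, n * h n ∂geometricMeasure p =
      ENNReal.ofReal (∑' n : ℕ, (1 - p : ℝ) ^ n * p * (n * (h n).toReal)) := by
    rw [← lintegral_ofReal_geometricMeasure hp (fun n => mul_nonneg n.cast_nonneg (g0 n))]
    · refine lintegral_congr fun n => ?_
      rw [ENNReal.ofReal_mul n.cast_nonneg, ← hg, ENNReal.ofReal_natCast]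
    · exact Summable.of_nonneg_of_le
        (fun n => mul_nonneg (hw n) (mul_nonneg n.cast_nonneg (g0 n)))
        (fun n => mul_le_mul_of_nonneg_left
          (mul_le_of_le_one_right n.cast_nonneg (g1 n)) (hw n)) hgeo1
  have n1 : 0 ≤ ∑' n, (1 - p : ℝ) ^ n * p * (h n).toReal :=
    tsum_nonneg fun n => mul_nonneg (hw n) (g0 n)
  have n2 : 0 ≤ ∑' n, (1 - p : ℝ) ^ n * p * (h n).toReal ^ 2 :=
    tsum_nonneg fun n => mul_nonneg (hw n) (sq_nonneg _)
  have n3 : 0 ≤ ∑' n : ℕ, (1 - p : ℝ) ^ n * p * (n * (h n).toReal) :=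
    tsum_nonneg fun n => mul_nonneg (hw n) (mul_nonneg n.cast_nonneg (g0 n))
  rw [e1, e2, e3, ← ENNReal.ofReal_mul hr0, ← ENNReal.ofReal_mul hp0.le,
    ← ENNReal.ofReal_pow n1, ← ENNReal.ofReal_add n2 (mul_nonneg hr0 n1),
    ← ENNReal.ofReal_add (mul_nonneg hp0.le n3) (sq_nonneg _)]
  exact ENNReal.ofReal_le_ofReal key

variable {B : Type*} [Fintype B]

open Classical in
/-- Tensorization of `geometric_variance_le` over the coordinates in `s`. -/
lemma lmarginal_variance_le {p : unitInterval} (hp : p ≠ 0) {F : (B → ℕ) → ℝ≥0∞}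
    (hm : Monotone F) (h1 : ∀ x, F x ≤ 1) (s : Finset B) (x : B → ℕ) :
    lmarginal (fun _ => geometricMeasure p) s (fun y => F y ^ 2) x +
        s.card * ENNReal.ofReal (1 - p) * lmarginal (fun _ => geometricMeasure p) s F x ≤
      ENNReal.ofReal p *
          lmarginal (fun _ => geometricMeasure p) s (fun y => ((∑ b ∈ s, y b : ℕ) : ℝ≥0∞) * F y) x +
        (lmarginal (fun _ => geometricMeasure p) s F x) ^ 2 := by
  have hle1 : ∀ (t : Finset B) (z : B → ℕ), lmarginal (fun _ => geometricMeasure p) t F z ≤ 1 := by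
    intro t z
    calc lmarginal (fun _ => geometricMeasure p) t F z
        ≤ lmarginal (fun _ => geometricMeasure p) t (fun _ => 1) z := lmarginal_mono h1 z
      _ = 1 := by simp [lmarginal]
  induction s using Finset.induction_on generalizing x with
  | empty => simp
  | insert b s hb ih =>
    set μ : B → Measure ℕ := fun _ => geometricMeasure p with hμ
    -- The average over the coordinates in `s`, as a function of coordinate `b`; it inherits
    -- monotonicity and the bound 1 from `F`.
    set H : ℕ → ℝ≥0∞ := fun n => lmarginal μ s F (Function.update x b n) with hH
    have hHm : Monotone H := by
      intro n n' hn
      refine lintegral_mono fun y => hm fun c => ?_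
      simp only [Function.updateFinset]
      split_ifs with hc
      · exact le_rfl
      · rcases eq_or_ne c b with rfl | hcb
        · simpa using hn
        · simp [Function.update_of_ne hcb]
    have one := geometric_variance_le hp hHm (fun n => hle1 s _)
    have int := lintegral_mono (μ := geometricMeasure p) fun n => ih (Function.update x b n)
    rw [lmarginal_insert _ (.of_discrete) hb, lmarginal_insert _ (.of_discrete) hb,
      lmarginal_insert _ (.of_discrete) hb]
    rw [lintegral_add_left .of_discrete, lintegral_add_left .of_discrete,
      lintegral_const_mul _ .of_discrete, lintegral_const_mul _ .of_discrete] at int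
    have split : ∫⁻ n, lmarginal μ s (fun y => ((∑ c ∈ insert b s, y c : ℕ) : ℝ≥0∞) * F y)
          (Function.update x b n) ∂geometricMeasure p =
        ∫⁻ n : ℕ, n * H n ∂geometricMeasure p +
          ∫⁻ n, lmarginal μ s (fun y => ((∑ c ∈ s, y c : ℕ) : ℝ≥0∞) * F y)
            (Function.update x b n) ∂geometricMeasure p := by
      rw [← lintegral_add_left .of_discrete]
      refine lintegral_congr fun n => ?_
      simp only [hH, lmarginal]
      rw [← lintegral_const_mul _ .of_discrete, ← lintegral_add_left .of_discrete]
      refine lintegral_congr fun y => ?_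
      rw [Finset.sum_insert hb, Nat.cast_add, add_mul]
      congr 3
      simp [Function.updateFinset, hb]
    rw [split, Finset.card_insert_of_notMem hb]
    -- Law of total variance: adding `int` and `one` puts `∫ H ^ 2` on both sides, and finiteness
    -- lets it cancel.
    have hfin : ∫⁻ n, H n ^ 2 ∂geometricMeasure p ≠ ⊤ := by
      refine ne_top_of_le_ne_top ENNReal.one_ne_top ?_
      calc ∫⁻ n, H n ^ 2 ∂geometricMeasure p ≤ ∫⁻ n, 1 ∂geometricMeasure p :=
            lintegral_mono fun n => pow_le_one₀ zero_le (hle1 s _)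
        _ = 1 := by simp
    refine (ENNReal.add_le_add_iff_right hfin).1 ?_
    have tot := add_le_add int one
    rw [Nat.cast_succ]
    calc _ = _ := by ring
      _ ≤ _ := tot
      _ = _ := by ring

/-- The Efron–Stein type bound `Var F ≤ p * Cov (∑ b, x b, F)` under a product of geometric
measures, for the indicator `F` of an upper set `M`. -/
lemma geometric_pi_variance_le {p : unitInterval} (hp : p ≠ 0) {M : Set (B → ℕ)}
    (hM : IsUpperSet M) :
    (Measure.pi fun _ : B => geometricMeasure p) M +
        Fintype.card B * ENNReal.ofReal (1 - p) * (Measure.pi fun _ : B => geometricMeasure p) M ≤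
      ENNReal.ofReal p * ∫⁻ x in M, ((∑ b, x b : ℕ) : ℝ≥0∞)
          ∂(Measure.pi fun _ : B => geometricMeasure p) +
        ((Measure.pi fun _ : B => geometricMeasure p) M) ^ 2 := by
  classical
  have hmeas : MeasurableSet M := .of_discrete
  have key := lmarginal_variance_le hp (F := M.indicator fun _ => 1) (fun x y hxy => by
    by_cases hx : x ∈ M
    · simp [hx, hM hxy hx]
    · simp [hx]) (fun x => Set.indicator_le_self' (fun _ _ => zero_le) x) Finset.univ 0
  simp only [lmarginal_univ] at key
  have e1 : ∀ x, (M.indicator (fun _ => (1 : ℝ≥0∞)) x) ^ 2 = M.indicator (fun _ => 1) x := by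
    intro x
    by_cases hx : x ∈ M <;> simp [hx]
  have e2 : ∀ x : B → ℕ, ((∑ b, x b : ℕ) : ℝ≥0∞) * M.indicator (fun _ => 1) x =
      M.indicator (fun x => ((∑ b, x b : ℕ) : ℝ≥0∞)) x := by
    intro x
    by_cases hx : x ∈ M <;> simp [hx]
  simp only [e1, e2] at key
  rw [lintegral_indicator hmeas, lintegral_indicator hmeas] at key
  simpa using key

end Poincare

/-! ### Power series for the mass, Russo's formula, growth of the odds. -/

section Series

variable {B : Type*} [Fintype B]

lemma summable_level (M : Set (B → ℕ)) (k : ℕ) {r : ℝ} (hr0 : 0 < r) (hr1 : r < 1) :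
    Summable fun n : ℕ => (n : ℝ) ^ k * ((level M n).card * r ^ n) := by
  have h := (summable_nat_add_iff 1).2 (summable_pow_mul_geometric_of_norm_lt_one
    (k + Fintype.card B) (r := r) (by rwa [Real.norm_of_nonneg hr0.le]))
  refine Summable.of_nonneg_of_le (fun n => by positivity) (fun n => ?_) (h.mul_right r⁻¹)
  have h1 : ((level M n).card : ℝ) ≤ ((n : ℝ) + 1) ^ Fintype.card B := by
    exact_mod_cast card_level_le_pow M n
  have h2 : (n : ℝ) ^ k ≤ ((n : ℝ) + 1) ^ k := by gcongr; linarith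
  calc (n : ℝ) ^ k * ((level M n).card * r ^ n)
      ≤ ((n : ℝ) + 1) ^ k * (((n : ℝ) + 1) ^ Fintype.card B * r ^ n) := by gcongr
    _ = _ := by
      push_cast
      rw [pow_succ r n, pow_add]
      field_simp

/-- The mass of `M` under the product of `#B` geometric distributions `n ↦ (1 - r) * r ^ n`,
as a power series in `r`. -/
noncomputable def geometricMass (M : Set (B → ℕ)) (r : ℝ) : ℝ :=
  (1 - r) ^ Fintype.card B * ∑' n, (level M n).card * r ^ n

/-- A point of total size `n` has mass `(1 - p) ^ n * p ^ #B`, so the product law is uniform on each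
level. This is the link between the two models. -/
lemma lintegral_pi_geometric {p : unitInterval} (hp : p ≠ 0) (M : Set (B → ℕ)) (φ : ℕ → ℝ≥0∞) :
    ∫⁻ x in M, φ (∑ b, x b) ∂(Measure.pi fun _ : B => geometricMeasure p) =
      ∑' n, φ n * ENNReal.ofReal ((level M n).card * ((1 - p : ℝ) ^ n * (p : ℝ) ^ Fintype.card B)) := by
  set π := Measure.pi fun _ : B => geometricMeasure p
  have hr0 : 0 ≤ 1 - (p : ℝ) := by linarith [p.2.2]
  have hp0 : 0 ≤ (p : ℝ) := p.2.1
  have hsing : ∀ x : B → ℕ, π {x} =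
      ENNReal.ofReal ((1 - p : ℝ) ^ (∑ b, x b) * (p : ℝ) ^ Fintype.card B) := by
    intro x
    simp only [π, Measure.pi_singleton, geometricMeasure_singleton hp]
    rw [← ENNReal.ofReal_prod_of_nonneg fun b _ => geometricMeasure_nonneg p (x b),
      Finset.prod_mul_distrib, Finset.prod_pow_eq_pow_sum]
    simp
  have hN : Measurable fun x : B → ℕ => ∑ b, x b := .of_discrete
  rw [← lintegral_map (f := φ) .of_discrete hN, lintegral_countable']
  refine tsum_congr fun n => ?_
  congr 1
  rw [Measure.map_apply hN .of_discrete, Measure.restrict_apply .of_discrete]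
  have : (fun x : B → ℕ => ∑ b, x b) ⁻¹' {n} ∩ M = (level M n : Set (B → ℕ)) := by
    ext f; simp [mem_level]
  rw [this, ← sum_measure_singleton, Finset.sum_congr rfl fun x hx => by
    rw [hsing x, (mem_level.1 hx).1]]
  rw [Finset.sum_const, nsmul_eq_mul, ← ENNReal.ofReal_natCast,
    ← ENNReal.ofReal_mul (by positivity)]

lemma setLIntegral_pow_pi_geometric {p : unitInterval} (hp0 : 0 < (p : ℝ)) (hp1 : (p : ℝ) < 1)
    (M : Set (B → ℕ)) (k : ℕ) :
    ∫⁻ x in M, ((∑ b, x b : ℕ) : ℝ≥0∞) ^ k ∂(Measure.pi fun _ : B => geometricMeasure p) =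
      ENNReal.ofReal ((p : ℝ) ^ Fintype.card B *
        ∑' n : ℕ, (n : ℝ) ^ k * ((level M n).card * (1 - p : ℝ) ^ n)) := by
  have hp : p ≠ 0 := fun h => by simp [h] at hp0
  have hr : 0 < 1 - (p : ℝ) := by linarith
  rw [lintegral_pi_geometric hp M fun n => (n : ℝ≥0∞) ^ k, ← tsum_mul_left,
    ENNReal.ofReal_tsum_of_nonneg (fun n => by positivity)
      ((summable_level M k hr (by linarith)).mul_left _)]
  refine tsum_congr fun n => ?_
  rw [← ENNReal.ofReal_natCast, ← ENNReal.ofReal_pow (by positivity),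
    ← ENNReal.ofReal_mul (by positivity)]
  congr 1
  ring

lemma pi_geometric_apply {p : unitInterval} (hp0 : 0 < (p : ℝ)) (hp1 : (p : ℝ) < 1)
    (M : Set (B → ℕ)) :
    (Measure.pi fun _ : B => geometricMeasure p) M =
      ENNReal.ofReal (geometricMass M (1 - p)) := by
  have h := setLIntegral_pow_pi_geometric hp0 hp1 M 0
  simpa [geometricMass] using h

lemma geometricMass_nonneg (M : Set (B → ℕ)) {r : ℝ} (hr0 : 0 ≤ r) (hr1 : r ≤ 1) :
    0 ≤ geometricMass M r :=
  mul_nonneg (pow_nonneg (by linarith) _) (tsum_nonneg fun n => by positivity)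

lemma geometricMass_univ {r : ℝ} (hr0 : 0 < r) (hr1 : r < 1) :
    geometricMass (Set.univ : Set (B → ℕ)) r = 1 := by
  have h := pi_geometric_apply (B := B) (p := ⟨1 - r, by linarith, by linarith⟩)
    (by simpa using hr1) (by simpa using hr0) Set.univ
  simp only [measure_univ, sub_sub_cancel] at h
  rw [← ENNReal.ofReal_one] at h
  exact ((ENNReal.ofReal_eq_ofReal_iff zero_le_one
    (geometricMass_nonneg _ hr0.le hr1.le)).1 h).symm

lemma geometricMass_pos {M : Set (B → ℕ)} (hM : M.Nonempty) {r : ℝ} (hr0 : 0 < r) (hr1 : r < 1) :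
    0 < geometricMass M r := by
  obtain ⟨x, hx⟩ := hM
  refine mul_pos (pow_pos (by linarith) _) ?_
  have hs := summable_level M 0 hr0 hr1
  simp only [pow_zero, one_mul] at hs
  refine hs.tsum_pos (fun n => by positivity) (∑ b, x b) ?_
  have : 0 < (level M (∑ b, x b)).card := Finset.card_pos.2 ⟨x, mem_level.2 ⟨rfl, hx⟩⟩
  positivity

/-- The mean of the total size, restricted to `M`. -/
noncomputable def geometricMean (M : Set (B → ℕ)) (r : ℝ) : ℝ :=
  (1 - r) ^ Fintype.card B * ∑' n : ℕ, n * ((level M n).card * r ^ n)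

lemma geometricMass_variance_le {M : Set (B → ℕ)} (hM : IsUpperSet M) {r : ℝ} (hr0 : 0 < r)
    (hr1 : r < 1) :
    geometricMass M r + Fintype.card B * r * geometricMass M r ≤
      (1 - r) * geometricMean M r + geometricMass M r ^ 2 := by
  let p : unitInterval := ⟨1 - r, by linarith, by linarith⟩
  have hp0 : 0 < (p : ℝ) := by simpa [p] using hr1
  have hp1 : (p : ℝ) < 1 := by simpa [p] using hr0
  have hp : p ≠ 0 := fun h => by simp [h] at hp0
  have hpr : 1 - (p : ℝ) = r := by simp [p]
  have hpv : (p : ℝ) = 1 - r := rfl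
  have key := geometric_pi_variance_le hp hM
  have e := setLIntegral_pow_pi_geometric hp0 hp1 M 1
  simp only [pow_one] at e
  have hmean : (p : ℝ) ^ Fintype.card B *
      ∑' n : ℕ, (n : ℝ) * ((level M n).card * (1 - p : ℝ) ^ n) = geometricMean M r := by
    rw [hpr, hpv, geometricMean]
  have hV := geometricMass_nonneg M hr0.le hr1.le
  have hE : 0 ≤ geometricMean M r :=
    mul_nonneg (pow_nonneg (by linarith) _) (tsum_nonneg fun n => by positivity)
  rw [e, hmean, pi_geometric_apply hp0 hp1, hpr, hpv, ← ENNReal.ofReal_natCast,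
    ← ENNReal.ofReal_mul (by positivity), ← ENNReal.ofReal_mul (by positivity),
    ← ENNReal.ofReal_mul (by linarith), ← ENNReal.ofReal_pow hV,
    ← ENNReal.ofReal_add (by positivity) (by positivity),
    ← ENNReal.ofReal_add (mul_nonneg (by linarith) hE) (by positivity),
    ENNReal.ofReal_le_ofReal_iff (add_nonneg (mul_nonneg (by linarith) hE) (by positivity))] at key
  exact key

lemma hasDerivAt_tsum_level (M : Set (B → ℕ)) {r : ℝ} (hr0 : 0 < r) (hr1 : r < 1) :
    HasDerivAt (fun z : ℝ => ∑' n, (level M n).card * z ^ n)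
      (r⁻¹ * ∑' n : ℕ, n * ((level M n).card * r ^ n)) r := by
  -- On `(0, ρ)` the derivatives of the terms are dominated by their values at `ρ`, which are
  -- summable since levels grow polynomially.
  obtain ⟨ρ, hρ, hρ1⟩ := exists_between hr1
  have hρ0 : 0 < ρ := hr0.trans hρ
  have aux : ∀ {z : ℝ}, 0 < z → ∀ n : ℕ,
      ((level M n).card : ℝ) * (n * z ^ (n - 1)) = z⁻¹ * (n * ((level M n).card * z ^ n)) := by
    intro z hz n
    rcases n with _ | n
    · simp
    · rw [Nat.add_sub_cancel, pow_succ]; field_simp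
  have hu : Summable fun n : ℕ => ((level M n).card : ℝ) * (n * ρ ^ (n - 1)) := by
    have := (summable_level M 1 hρ0 hρ1).mul_left ρ⁻¹
    simp only [pow_one] at this
    exact this.congr fun n => (aux hρ0 n).symm
  have h0 := summable_level M 0 hr0 hr1
  simp only [pow_zero, one_mul] at h0
  have key := hasDerivAt_tsum_of_isPreconnected (t := Set.Ioo 0 ρ)
    (g := fun n z => ((level M n).card : ℝ) * z ^ n)
    (g' := fun n z => ((level M n).card : ℝ) * (n * z ^ (n - 1))) hu isOpen_Ioo
    isPreconnected_Ioo (fun n y _ => (hasDerivAt_pow n y).const_mul _) (fun n y hy => by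
      have hy0 := hy.1
      rw [Real.norm_of_nonneg (by positivity)]
      gcongr
      exact hy.2.le) ⟨hr0, hρ⟩ h0 ⟨hr0, hρ⟩
  rw [← tsum_mul_left]
  exact key.congr_deriv (tsum_congr fun n => aux hr0 n)

/-- Russo's formula. -/
lemma hasDerivAt_geometricMass [Nonempty B] (M : Set (B → ℕ)) {r : ℝ} (hr0 : 0 < r)
    (hr1 : r < 1) :
    HasDerivAt (geometricMass M)
      (((1 - r) * geometricMean M r - Fintype.card B * r * geometricMass M r) /
        (r * (1 - r))) r := by
  have h1 : HasDerivAt (fun z : ℝ => (1 - z) ^ Fintype.card B)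
      (Fintype.card B * (1 - r) ^ (Fintype.card B - 1) * (-1)) r :=
    ((hasDerivAt_id r).const_sub 1).pow _
  have h := h1.mul (hasDerivAt_tsum_level M hr0 hr1)
  refine h.congr_deriv ?_
  have hq : 0 < 1 - r := by linarith
  obtain ⟨k, hk⟩ := Nat.exists_eq_succ_of_ne_zero (Fintype.card_ne_zero (α := B))
  rw [geometricMean, geometricMass, hk, Nat.succ_eq_add_one, Nat.add_sub_cancel, pow_succ]
  field_simp
  ring

/-- The odds of `M` grow at least linearly in `r / (1 - r)`. -/
lemma antitoneOn_odds [Nonempty B] {M : Set (B → ℕ)} (hM : IsUpperSet M) (hne : M.Nonempty) :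
    AntitoneOn (fun r => r / (1 - r) * (1 / geometricMass M r - 1)) (Set.Ioo 0 1) := by
  have hd : ∀ r ∈ Set.Ioo (0 : ℝ) 1,
      HasDerivAt (fun r => r / (1 - r) * (1 / geometricMass M r - 1))
        ((1 * (1 - r) - r * (-1)) / (1 - r) ^ 2 * (1 / geometricMass M r - 1) +
          r / (1 - r) * (-(((1 - r) * geometricMean M r -
            Fintype.card B * r * geometricMass M r) / (r * (1 - r))) /
              geometricMass M r ^ 2)) r := by
    intro r hr
    have hq : 1 - r ≠ 0 := by linarith [hr.2]
    have hV := (geometricMass_pos hne hr.1 hr.2).ne'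
    have h1 := (hasDerivAt_id r).div ((hasDerivAt_id r).const_sub 1) hq
    have h2 := ((hasDerivAt_geometricMass M hr.1 hr.2).inv hV).sub_const 1
    simp only [one_div]
    exact h1.mul h2
  refine antitoneOn_of_deriv_nonpos (convex_Ioo 0 1)
    (fun r hr => (hd r hr).continuousAt.continuousWithinAt) ?_ ?_
  · rw [interior_Ioo]
    exact fun r hr => (hd r hr).differentiableAt.differentiableWithinAt
  · rw [interior_Ioo]
    intro r hr
    rw [(hd r hr).deriv]
    have hV := geometricMass_pos hne hr.1 hr.2
    have hq : 0 < 1 - r := by linarith [hr.2]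
    have hr0 := hr.1
    have key := geometricMass_variance_le hM hr.1 hr.2
    set V := geometricMass M r
    set E := geometricMean M r
    -- Up to a positive denominator, the derivative is the left side minus the right side of the
    -- variance inequality `key`.
    have : (1 * (1 - r) - r * (-1)) / (1 - r) ^ 2 * (1 / V - 1) +
        r / (1 - r) * (-(((1 - r) * E - Fintype.card B * r * V) / (r * (1 - r))) / V ^ 2) =
        (V + Fintype.card B * r * V - ((1 - r) * E + V ^ 2)) / ((1 - r) ^ 2 * V ^ 2) := by
      field_simp
      ring
    rw [this]
    exact div_nonpos_of_nonpos_of_nonneg (by linarith) (by positivity)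

end Series

/-! ### Variance of the total size and Chebyshev bounds. -/

section Concentration

variable {B : Type*} [Fintype B]

/-- The total size under the product of geometric distributions has mean `t = #B * r / (1 - r)` and
variance `t / (1 - r)`. -/
lemma hasSum_geometric_variance {r t : ℝ} (hr0 : 0 < r) (hr1 : r < 1)
    (ht : t = Fintype.card B * r / (1 - r)) :
    HasSum (fun n : ℕ => (1 - r) ^ Fintype.card B *
      (((n : ℝ) - t) ^ 2 * ((level (Set.univ : Set (B → ℕ)) n).card * r ^ n))) (t / (1 - r)) := by
  set a : ℕ → ℝ := fun n => (level (Set.univ : Set (B → ℕ)) n).card * r ^ n with ha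
  set m : ℝ := (Fintype.card B : ℝ)
  have hq : 0 < 1 - r := by linarith
  -- This recurrence yields linear equations for the first two moments, with no closed form for the
  -- level sizes.
  have hrec : ∀ n : ℕ, ((n : ℝ) + 1) * a (n + 1) = r * ((n + m) * a n) := by
    intro n
    have h : ((n : ℝ) + 1) * (level (Set.univ : Set (B → ℕ)) (n + 1)).card =
        (n + m) * (level (Set.univ : Set (B → ℕ)) n).card := by
      simp only [m]
      exact_mod_cast card_level_univ_succ (B := B) n
    simp only [ha]
    rw [pow_succ]
    linear_combination r ^ n * r * h
  have s0 : Summable a := by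
    simpa using summable_level (Set.univ : Set (B → ℕ)) 0 hr0 hr1
  have s1 : Summable fun n : ℕ => (n : ℝ) * a n := by
    simpa using summable_level (Set.univ : Set (B → ℕ)) 1 hr0 hr1
  have s2 : Summable fun n : ℕ => (n : ℝ) ^ 2 * a n :=
    summable_level (Set.univ : Set (B → ℕ)) 2 hr0 hr1
  have m0 : (1 - r) ^ Fintype.card B * ∑' n, a n = 1 := geometricMass_univ (B := B) hr0 hr1
  have m1 : ∑' n : ℕ, (n : ℝ) * a n = r * (∑' n : ℕ, (n : ℝ) * a n + m * ∑' n, a n) := by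
    rw [← tsum_mul_left (a := m), ← s1.tsum_add (s0.mul_left m), ← tsum_mul_left]
    nth_rw 1 [s1.tsum_eq_zero_add]
    simp only [Nat.cast_zero, zero_mul, zero_add, Nat.cast_add, Nat.cast_one]
    exact tsum_congr fun n => by rw [hrec]; ring
  have m2 : ∑' n : ℕ, (n : ℝ) ^ 2 * a n = r * (∑' n : ℕ, (n : ℝ) ^ 2 * a n +
      ((m + 1) * ∑' n : ℕ, (n : ℝ) * a n + m * ∑' n, a n)) := by
    rw [← tsum_mul_left (a := m), ← tsum_mul_left (a := m + 1),
      ← (s1.mul_left (m + 1)).tsum_add (s0.mul_left m),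
      ← s2.tsum_add ((s1.mul_left (m + 1)).add (s0.mul_left m)), ← tsum_mul_left]
    nth_rw 1 [s2.tsum_eq_zero_add]
    simp only [Nat.cast_zero, zero_mul, zero_add, Nat.cast_add, Nat.cast_one, ne_eq,
      OfNat.ofNat_ne_zero, not_false_eq_true, zero_pow]
    exact tsum_congr fun n => by rw [pow_two, mul_assoc, hrec]; ring
  have hs : HasSum (fun n : ℕ => ((n : ℝ) - t) ^ 2 * a n)
      (∑' n : ℕ, (n : ℝ) ^ 2 * a n - 2 * t * ∑' n : ℕ, (n : ℝ) * a n + t ^ 2 * ∑' n, a n) := by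
    refine ((s2.hasSum.sub (s1.hasSum.mul_left (2 * t))).add
      (s0.hasSum.mul_left (t ^ 2))).congr_fun fun n => ?_
    ring
  have key := hs.mul_left ((1 - r) ^ Fintype.card B)
  set Q := (1 - r) ^ Fintype.card B
  set A0 := ∑' n, a n
  set A1 := ∑' n : ℕ, (n : ℝ) * a n
  set A2 := ∑' n : ℕ, (n : ℝ) ^ 2 * a n
  have ht' : t * (1 - r) = m * r := by rw [ht]; field_simp
  have k1 : Q * A1 = t := by
    have : (1 - r) * (Q * A1) = (1 - r) * t := by
      linear_combination Q * m1 + r * m * m0 - ht'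
    exact mul_left_cancel₀ hq.ne' this
  have k2 : (1 - r) * (Q * A2) = r * ((m + 1) * t + m) := by
    linear_combination Q * m2 + r * (m + 1) * k1 + r * m * m0
  have he : t / (1 - r) = Q * (A2 - 2 * t * A1 + t ^ 2 * A0) := by
    rw [div_eq_iff hq.ne']
    linear_combination (-1) * k2 + 2 * t * (1 - r) * k1 - t ^ 2 * (1 - r) * m0 + (1 + t) * ht'
  rwa [he]

variable {M : Set (B → ℕ)} {r t δ : ℝ}

/-- Chebyshev, level by level: the share of `M` is at most `1/2 + (n - t) ^ 2 / (2 δ ^ 2)`, by `h`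
below `t + δ` and because this bound is at least 1 from there on. -/
lemma geometricMass_le_of_card_level_le (hr0 : 0 < r) (hr1 : r < 1)
    (ht : t = Fintype.card B * r / (1 - r)) (hδ : 0 < δ)
    (h : ∀ n : ℕ, n < t + δ →
      2 * ((level M n).card : ℝ) ≤ (level (Set.univ : Set (B → ℕ)) n).card) :
    geometricMass M r ≤ 1 / 2 + t / (1 - r) / (2 * δ ^ 2) := by
  have hq : 0 < 1 - r := by linarith
  have s0 := (summable_level (Set.univ : Set (B → ℕ)) 0 hr0 hr1).hasSum.mul_left
    ((1 - r) ^ Fintype.card B)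
  have sM := (summable_level M 0 hr0 hr1).hasSum.mul_left ((1 - r) ^ Fintype.card B)
  simp only [pow_zero, one_mul] at s0 sM
  have m0 := geometricMass_univ (B := B) hr0 hr1
  rw [geometricMass] at m0
  rw [m0] at s0
  have sV := hasSum_geometric_variance (B := B) hr0 hr1 ht
  have tot := (s0.mul_left (1 / 2)).add (sV.mul_right (1 / (2 * δ ^ 2)))
  have := hasSum_le (fun n => ?_) sM tot
  · rw [geometricMass]
    refine this.trans (le_of_eq ?_)
    ring
  have hcoef : ((level M n).card : ℝ) ≤
      (1 / 2 + ((n : ℝ) - t) ^ 2 / (2 * δ ^ 2)) * (level (Set.univ : Set (B → ℕ)) n).card := by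
    have hle : ((level M n).card : ℝ) ≤ (level (Set.univ : Set (B → ℕ)) n).card := by
      exact_mod_cast Finset.card_le_card (level_subset_univ M n)
    have ha : (0 : ℝ) ≤ (level (Set.univ : Set (B → ℕ)) n).card := by positivity
    rcases lt_or_ge (n : ℝ) (t + δ) with hn | hn
    · have h1 := h n hn
      have h2 : 0 ≤ ((n : ℝ) - t) ^ 2 / (2 * δ ^ 2) * (level (Set.univ : Set (B → ℕ)) n).card := by
        positivity
      linarith
    · have h2 : 1 / 2 ≤ ((n : ℝ) - t) ^ 2 / (2 * δ ^ 2) := by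
        rw [le_div_iff₀ (by positivity)]
        have : δ ^ 2 ≤ ((n : ℝ) - t) ^ 2 := by gcongr; linarith
        linarith
      have h3 := mul_le_mul_of_nonneg_right h2 ha
      linarith
  have hw : 0 ≤ (1 - r) ^ Fintype.card B * r ^ n := by positivity
  have := mul_le_mul_of_nonneg_left hcoef hw
  calc _ = (1 - r) ^ Fintype.card B * r ^ n * (level M n).card := by ring
    _ ≤ _ := this
    _ = _ := by ring

/-- The mirror image: the minorant `1/2 - (n - t) ^ 2 / (2 δ ^ 2)` is nonpositive for `n ≤ t - δ`.
-/
lemma le_geometricMass_of_le_card_level (hr0 : 0 < r) (hr1 : r < 1)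
    (ht : t = Fintype.card B * r / (1 - r)) (hδ : 0 < δ)
    (h : ∀ n : ℕ, t - δ < n →
      ((level (Set.univ : Set (B → ℕ)) n).card : ℝ) ≤ 2 * (level M n).card) :
    1 / 2 - t / (1 - r) / (2 * δ ^ 2) ≤ geometricMass M r := by
  have hq : 0 < 1 - r := by linarith
  have s0 := (summable_level (Set.univ : Set (B → ℕ)) 0 hr0 hr1).hasSum.mul_left
    ((1 - r) ^ Fintype.card B)
  have sM := (summable_level M 0 hr0 hr1).hasSum.mul_left ((1 - r) ^ Fintype.card B)
  simp only [pow_zero, one_mul] at s0 sM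
  have m0 := geometricMass_univ (B := B) hr0 hr1
  rw [geometricMass] at m0
  rw [m0] at s0
  have sV := hasSum_geometric_variance (B := B) hr0 hr1 ht
  have tot := (s0.mul_left (1 / 2)).sub (sV.mul_right (1 / (2 * δ ^ 2)))
  have := hasSum_le (fun n => ?_) tot sM
  · rw [geometricMass]
    refine (le_of_eq ?_).trans this
    ring
  have hcoef : (1 / 2 - ((n : ℝ) - t) ^ 2 / (2 * δ ^ 2)) *
      (level (Set.univ : Set (B → ℕ)) n).card ≤ ((level M n).card : ℝ) := by
    have ha : (0 : ℝ) ≤ (level (Set.univ : Set (B → ℕ)) n).card := by positivity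
    have hc : (0 : ℝ) ≤ (level M n).card := by positivity
    rcases lt_or_ge (t - δ) (n : ℝ) with hn | hn
    · have h1 := h n hn
      have h2 : 0 ≤ ((n : ℝ) - t) ^ 2 / (2 * δ ^ 2) * (level (Set.univ : Set (B → ℕ)) n).card := by
        positivity
      linarith
    · have h2 : 1 / 2 ≤ ((n : ℝ) - t) ^ 2 / (2 * δ ^ 2) := by
        rw [le_div_iff₀ (by positivity)]
        have : δ ^ 2 ≤ (t - (n : ℝ)) ^ 2 := by gcongr; linarith
        nlinarith
      have h3 := mul_le_mul_of_nonneg_right h2 ha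
      linarith
  have hw : 0 ≤ (1 - r) ^ Fintype.card B * r ^ n := by positivity
  have := mul_le_mul_of_nonneg_left hcoef hw
  calc _ = _ := by ring
    _ ≤ _ := this
    _ = (1 - r) ^ Fintype.card B * ((level M n).card * r ^ n) := by ring

end Concentration

/-! ### Comparison of the two thresholds. -/

section Thresholds

variable {B : Type*} [Fintype B] [Nonempty B] {M : Set (B → ℕ)}

/-- The ratio `r` of the geometric distribution with mean `U / #B`. -/
noncomputable def geometricRatio (B : Type*) [Fintype B] (U : ℝ) : ℝ := U / (Fintype.card B + U)

lemma card_cast_pos : (0 : ℝ) < Fintype.card B := by exact_mod_cast Fintype.card_pos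

lemma geometricRatio_mem {U : ℝ} (hU : 0 < U) : geometricRatio B U ∈ Set.Ioo (0 : ℝ) 1 := by
  have hm := card_cast_pos (B := B)
  refine ⟨by unfold geometricRatio; positivity, ?_⟩
  rw [geometricRatio, div_lt_one (by positivity)]
  linarith

lemma one_sub_geometricRatio {U : ℝ} (hU : 0 < U) :
    1 - geometricRatio B U = Fintype.card B / (Fintype.card B + U) := by
  have hm := card_cast_pos (B := B)
  rw [geometricRatio]
  field_simp
  ring

lemma geometricRatio_div {U : ℝ} (hU : 0 < U) :
    geometricRatio B U / (1 - geometricRatio B U) = U / Fintype.card B := by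
  have hm := card_cast_pos (B := B)
  rw [one_sub_geometricRatio hU, geometricRatio]
  field_simp

lemma geometricRatio_le {U V : ℝ} (hU : 0 < U) (h : U ≤ V) :
    geometricRatio B U ≤ geometricRatio B V := by
  have hm := card_cast_pos (B := B)
  rw [geometricRatio, geometricRatio, div_le_div_iff₀ (by positivity) (by linarith)]
  nlinarith

lemma geometricMultiset_apply {U : ℝ≥0} (hU : 0 < U) :
    geometricMultiset B U M = ENNReal.ofReal (geometricMass M (geometricRatio B U)) := by
  have hm := card_cast_pos (B := B)
  have hU' : (0 : ℝ) < U := hU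
  have hp : (geometricParam B U : ℝ) = 1 - geometricRatio B U := by
    rw [one_sub_geometricRatio hU', geometricParam]
    field_simp
  have hr := geometricRatio_mem (B := B) hU'
  rw [geometricMultiset, pi_geometric_apply (by rw [hp]; linarith [hr.2])
    (by rw [hp]; linarith [hr.1]), hp, sub_sub_cancel]

lemma IsGeometricThreshold.geometricMass_eq {T' : ℝ≥0} (h : IsGeometricThreshold M T') :
    geometricMass M (geometricRatio B T') = 1 / 2 := by
  have hr := geometricRatio_mem (B := B) (U := T') h.1
  have h2 := h.2
  rw [geometricMultiset_apply h.1] at h2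
  have h3 := congrArg ENNReal.toReal h2
  rw [ENNReal.toReal_ofReal (geometricMass_nonneg _ hr.1.le hr.2.le)] at h3
  simpa using h3

/-- The odds are 1 at mean `T'` and grow at least linearly in the mean, so at `U` they are at least
`U / T'`. -/
lemma IsGeometricThreshold.le_geometricMass {T' : ℝ≥0} (h : IsGeometricThreshold M T')
    (hM : IsUpperSet M) (hne : M.Nonempty) {U : ℝ} (hU : (T' : ℝ) ≤ U) :
    U / (U + T') ≤ geometricMass M (geometricRatio B U) := by
  have hT : (0 : ℝ) < T' := h.1
  have hU0 : 0 < U := hT.trans_le hU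
  have hm := card_cast_pos (B := B)
  have hr := geometricRatio_mem (B := B) hU0
  have key := antitoneOn_odds hM hne (geometricRatio_mem hT) hr (geometricRatio_le hT hU)
  have hV := geometricMass_pos hne hr.1 hr.2
  simp only [geometricRatio_div hT, geometricRatio_div hU0, h.geometricMass_eq] at key
  set V := geometricMass M (geometricRatio B U)
  rw [div_mul_eq_mul_div, div_mul_eq_mul_div, div_le_div_iff_of_pos_right hm] at key
  have h2 : U * (1 / V - 1) * V ≤ T' * (1 / (1 / 2) - 1) * V := by gcongr
  have h3 : U * (1 / V - 1) * V = U - U * V := by field_simp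
  rw [div_le_iff₀ (by positivity)]
  linarith

lemma IsGeometricThreshold.geometricMass_le {T' : ℝ≥0} (h : IsGeometricThreshold M T')
    (hM : IsUpperSet M) (hne : M.Nonempty) {U : ℝ} (hU0 : 0 < U) (hU : U ≤ T') :
    geometricMass M (geometricRatio B U) ≤ U / (U + T') := by
  have hT : (0 : ℝ) < T' := h.1
  have hm := card_cast_pos (B := B)
  have hr := geometricRatio_mem (B := B) hU0
  have key := antitoneOn_odds hM hne hr (geometricRatio_mem hT) (geometricRatio_le hU0 hU)
  have hV := geometricMass_pos hne hr.1 hr.2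
  simp only [geometricRatio_div hT, geometricRatio_div hU0, h.geometricMass_eq] at key
  set V := geometricMass M (geometricRatio B U)
  rw [div_mul_eq_mul_div, div_mul_eq_mul_div, div_le_div_iff_of_pos_right hm] at key
  have h2 : T' * (1 / (1 / 2) - 1) * V ≤ U * (1 / V - 1) * V := by gcongr
  have h3 : U * (1 / V - 1) * V = U - U * V := by field_simp
  rw [le_div_iff₀ (by positivity)]
  linarith

lemma geometricRatio_mean {U : ℝ} (hU : 0 < U) :
    U = Fintype.card B * geometricRatio B U / (1 - geometricRatio B U) := by
  have hm := card_cast_pos (B := B)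
  rw [mul_div_assoc, geometricRatio_div hU]
  field_simp

/-- Chebyshev's error term for a mean `U ≤ 2 * T'` and a deviation of `ε / 2 * T'`. -/
lemma chebyshev_error_lt {T' U ε : ℝ} (hT' : 0 < T') (hε : 0 < ε) (hU : 0 < U) (hU2 : U ≤ 2 * T')
    (h : 4 / T' + 8 / (Fintype.card B : ℝ) < ε ^ 3 / 10) :
    U / (1 - geometricRatio B U) / (2 * (ε / 2 * T') ^ 2) < ε / 10 := by
  have hm := card_cast_pos (B := B)
  rw [one_sub_geometricRatio hU]
  -- The variance is `U + U ^ 2 / #B`; its two terms yield the errors controlled by large `T'` and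
  -- by large `#B`.
  calc U / (Fintype.card B / (Fintype.card B + U)) / (2 * (ε / 2 * T') ^ 2)
      = (U + U ^ 2 / Fintype.card B) / (2 * (ε / 2 * T') ^ 2) := by field_simp
    _ ≤ (2 * T' + (2 * T') ^ 2 / Fintype.card B) / (2 * (ε / 2 * T') ^ 2) := by gcongr
    _ = (4 / T' + 8 / (Fintype.card B : ℝ)) / ε ^ 2 := by field_simp; ring
    _ < (ε ^ 3 / 10) / ε ^ 2 := by gcongr
    _ = ε / 10 := by field_simp

lemma IsUniformThreshold.le_mul {T : ℕ} {T' : ℝ≥0} (hT : IsUniformThreshold M T)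
    (hT' : IsGeometricThreshold M T') (hM : IsUpperSet M) (hne : M.Nonempty) {ε : ℝ}
    (hε : 0 < ε) (hε1 : ε < 1)
    (h : 4 / (T' : ℝ) + 8 / (Fintype.card B : ℝ) < ε ^ 3 / 10) :
    (T : ℝ) ≤ (1 + ε) * T' := by
  have hT0 : (0 : ℝ) < T' := hT'.1
  by_contra! hcon
  -- The midpoint of `T'` and `(1 + ε) T'`. With `δ = ε / 2 * T'`, all levels below `U + δ` lie
  -- below `T`, where minimality of `T` keeps the share under 1/2.
  set U : ℝ := (1 + ε / 2) * T' with hUdef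
  have hU0 : 0 < U := by positivity
  have hr := geometricRatio_mem (B := B) hU0
  have hlow := hT'.le_geometricMass hM hne (U := U) (by nlinarith)
  have hup := geometricMass_le_of_card_level_le (M := M) hr.1 hr.2 (geometricRatio_mean hU0)
    (δ := ε / 2 * T') (by positivity) (fun n hn => by
      have hnT : n < T := by
        have : (n : ℝ) < T := by linarith
        exact_mod_cast this
      by_contra! hlt
      have : T ≤ n := hT.2 ((half_le_uniformMultiset_iff M n).2 hlt.le)
      omega)
  have herr := chebyshev_error_lt (B := B) hT0 hε hU0 (by nlinarith) h
  -- The exact gap is `ε / (8 + 2 ε)`, which exceeds `ε / 10` as `ε < 1`.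
  have hgap : 1 / 2 + ε / 10 ≤ U / (U + T') := by
    rw [le_div_iff₀ (by positivity), hUdef]
    nlinarith [mul_pos hε hT0, mul_pos (mul_pos hε hT0) (sub_pos.2 hε1)]
  linarith

lemma IsUniformThreshold.mul_le {T : ℕ} {T' : ℝ≥0} (hT : IsUniformThreshold M T)
    (hT' : IsGeometricThreshold M T') (hM : IsUpperSet M) (hne : M.Nonempty) {ε : ℝ}
    (hε : 0 < ε) (hε1 : ε < 1)
    (h : 4 / (T' : ℝ) + 8 / (Fintype.card B : ℝ) < ε ^ 3 / 10) :
    (1 - ε) * T' ≤ T := by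
  have hT0 : (0 : ℝ) < T' := hT'.1
  by_contra! hcon
  set U : ℝ := (1 - ε / 2) * T' with hUdef
  have hU0 : 0 < U := mul_pos (by linarith) hT0
  have hr := geometricRatio_mem (B := B) hU0
  have hup := hT'.geometricMass_le hM hne hU0 (by nlinarith)
  have hlow := le_geometricMass_of_le_card_level (M := M) hr.1 hr.2 (geometricRatio_mean hU0)
    (δ := ε / 2 * T') (by positivity) (fun n hn => by
      have hnT : T ≤ n := by
        have : (T : ℝ) < n := by linarith
        exact_mod_cast this.le
      have h1 := (half_le_uniformMultiset_iff M T).1 hT.1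
      -- Being the least good level says nothing about levels above `T`; monotonicity of the shares
      -- does.
      have h2 := monotone_level_ratio hM hnT
      have ha : (0 : ℝ) < (level (Set.univ : Set (B → ℕ)) T).card := by
        exact_mod_cast card_level_pos T
      have ha' : (0 : ℝ) < (level (Set.univ : Set (B → ℕ)) n).card := by
        exact_mod_cast card_level_pos n
      have h3 : (1 : ℝ) / 2 ≤ (level M T).card / (level (Set.univ : Set (B → ℕ)) T).card := by
        rw [le_div_iff₀ ha]; linarith
      have h4 := (le_div_iff₀ ha').1 (h3.trans h2)
      linarith)
  have herr := chebyshev_error_lt (B := B) hT0 hε hU0 (by nlinarith) h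
  have hgap : U / (U + T') ≤ 1 / 2 - ε / 10 := by
    rw [div_le_iff₀ (by positivity), hUdef]
    nlinarith [mul_pos hε hT0, mul_pos (mul_pos hε hT0) hε]
  linarith

end Thresholds

theorem theorem11 {B : ℕ → Type*} [∀ i, Fintype (B i)] [∀ i, Nonempty (B i)]
    (M : ∀ i, Set (B i → ℕ))
    (hne : ∀ i, (M i).Nonempty)
    (hup : ∀ i, IsUpperSet (M i))
    (hzero : ∀ i, (0 : B i → ℕ) ∉ M i)
    (T : ℕ → ℕ) (T' : ℕ → ℝ≥0)
    (hT : ∀ i, IsUniformThreshold (M i) (T i))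
    (hT' : ∀ i, IsGeometricThreshold (M i) (T' i))
    (hcard : Tendsto (fun i => Fintype.card (B i)) atTop atTop)
    (hlim : Tendsto T' atTop atTop) :
    Tendsto (fun i => (T i : ℝ) / (T' i : ℝ)) atTop (𝓝 1) := by
  have herr : Tendsto (fun i => 4 / (T' i : ℝ) + 8 / (Fintype.card (B i) : ℝ)) atTop (𝓝 0) := by
    have h1 : Tendsto (fun i => (T' i : ℝ)) atTop atTop := NNReal.tendsto_coe_atTop.2 hlim
    have h2 : Tendsto (fun i => (Fintype.card (B i) : ℝ)) atTop atTop :=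
      tendsto_natCast_atTop_atTop.comp hcard
    simpa using (h1.const_div_atTop 4).add (h2.const_div_atTop 8)
  rw [Metric.tendsto_nhds]
  intro ε hε
  -- The two bounds need a tolerance below 1, and the final estimate needs one strictly below `ε`.
  set η := min (ε / 2) (1 / 2) with hη
  have hη0 : 0 < η := by positivity
  have hη1 : η < 1 := (min_le_right _ _).trans_lt (by norm_num)
  have hηε : η < ε := (min_le_left _ _).trans_lt (by linarith)
  filter_upwards [herr.eventually_lt_const (show 0 < η ^ 3 / 10 by positivity)] with i hi
  have hT0 : (0 : ℝ) < T' i := (hT' i).1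
  have hu := (hT i).le_mul (hT' i) (hup i) (hne i) hη0 hη1 hi
  have hl := (hT i).mul_le (hT' i) (hup i) (hne i) hη0 hη1 hi
  rw [Real.dist_eq]
  refine lt_of_le_of_lt (abs_le.2 ⟨?_, ?_⟩) hηε
  · have := (le_div_iff₀ hT0).2 hl
    linarith
  · have := (div_le_iff₀ hT0).2 hu
    linarith
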